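/- Theorem (Ergodic continuity of nearest neighbor processes). Let $(\mathcal X,\rho)$ be a separable metric space of bounded diameter and $\nu$ a finite Borel measure on $\mathcal X$. Suppose that $(\mathcal X,\rho,\nu)$ is upper doubling: there are $d\ge 0$ and $c>0$ such that every open ball of radius $r>0$ can be covered by at most $2^d$ closed balls of radius $r/2$, and has $\nu$-mass at most $c\,r^d$. Then there are constants $c_1,c_2>0$, depending only on $(\mathcal X,\rho,\nu)$, such that the following holds. Let $\mathbb X=(X_n)_{n\ge 0}$ be a stochastic process in $\mathcal X$ that is uniformly dominated by $\nu$ at rate $\varepsilon(\cdot)$, that is, $\varepsilon(\delta)\to 0$ as $\delta\downarrow 0$, and for every $\delta>0$ and every measurable $A\subset\mathcal X$ with $\nu(A)<\delta$, $$\sup_{n\ge 1}\ \Pr\big(X_n\in A\,\big|\,X_0,\dots,X_{n-1}\big)<\varepsilon(\delta)\qquad\text{a.s.}$$ Let $\tilde{\mathbb X}=(\tilde X_n)_{n\ge 1}$ be any nearest neighbor process of $\mathbb X$, that is, $\tilde X_n\in\arg\min_{x\in\{X_0,\dots,X_{n-1}\}}\rho(X_n,x)$ for all $n\ge1$, almost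 surely. Then for every $\delta_0>0$ and every measurable $A\subset\mathcal X$ with $\nu(A)<\delta_0$, $$\limsup_{N\to\infty}\frac1N\sum_{n=1}^N\mathbf 1\{\tilde X_n\in A\}\;<\;\inf_{\delta>0}\Big\{\Big(c_1+c_2\log^+\tfrac1\delta\Big)\,\varepsilon(\delta_0)+\varepsilon(\delta)\Big\}\qquad\text{a.s.},$$ where $\log^+ t=\max(0,\log t)$. In particular, $\tilde{\mathbb X}$ is ergodically dominated by $\nu$: for every $e>0$ there is $\delta>0$ such that for every measurable $A$ with $\nu(A)<\delta$, almost surely $\limsup_{N\to\infty}\frac1N\sum_{n=1}^N\mathbf 1\{\tilde X_n\in A\}<e$. -/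

import Mathlib

open MeasureTheory Filter Topology

/-- A metric space is doubling with dimension `d` if every ball of radius `r` can be covered by at
most `2 ^ d` balls of radius `r / 2`. The covered ball is open and the covering balls are closed;
this is implied by the same condition with open balls only, and by the one with closed balls only
(so that, for instance, the real line has dimension `1`). -/
def IsDoublingSpace (𝒳 : Type*) [MetricSpace 𝒳] (d : ℝ) : Prop :=
  ∀ (x : 𝒳) (r : ℝ), 0 < r → ∃ t : Finset 𝒳, (t.card : ℝ) ≤ 2 ^ d ∧
    Metric.ball x r ⊆ ⋃ y ∈ t, Metric.closedBall y (r / 2)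

/-- `(𝒳, ρ, ν)` is upper doubling: it is doubling with some dimension `d`, and the mass of a ball
of radius `r` is at most `c * r ^ d` for some constant `c`, with the same `d`. -/
def IsUpperDoubling {𝒳 : Type*} [MetricSpace 𝒳] [MeasurableSpace 𝒳] (ν : Measure 𝒳) : Prop :=
  ∃ d : ℝ, 0 ≤ d ∧ IsDoublingSpace 𝒳 d ∧
    ∃ c : ℝ, 0 < c ∧ ∀ (x : 𝒳) (r : ℝ), 0 < r →
      ν (Metric.ball x r) ≤ ENNReal.ofReal (c * r ^ d)

/-- The σ-algebra generated by `X 0, …, X (n - 1)`. -/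
abbrev pastSigma {Ω 𝒳 : Type*} [MeasurableSpace 𝒳] (X : ℕ → Ω → 𝒳) (n : ℕ) : MeasurableSpace Ω :=
  ⨆ i : Fin n, MeasurableSpace.comap (X i) inferInstance

/-- (A version of) the conditional probability that `X n` lies in `A`, given `X 0, …, X (n - 1)`. -/
noncomputable def condProbMem {Ω 𝒳 : Type*} [MeasurableSpace Ω] [MeasurableSpace 𝒳]
    (P : Measure Ω) (X : ℕ → Ω → 𝒳) (n : ℕ) (A : Set 𝒳) : Ω → ℝ :=
  P[(X n ⁻¹' A).indicator (fun _ => (1 : ℝ)) | pastSigma X n]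

/-- The process `X` is uniformly dominated by `ν` at rate `ε`: `ε(δ) → 0` as `δ ↓ 0`, and if
`ν A < δ` then, almost surely, the conditional probabilities that `X n` lands in `A` given the
past satisfy `sup_{n ≥ 1} P(X n ∈ A | X 0, …, X (n - 1)) < ε(δ)`. -/
def UniformlyDominatedAtRate {Ω 𝒳 : Type*} [MeasurableSpace Ω] [MeasurableSpace 𝒳]
    (P : Measure Ω) (X : ℕ → Ω → 𝒳) (ν : Measure 𝒳) (ε : ℝ → ℝ) : Prop :=
  Tendsto ε (𝓝[>] 0) (𝓝 0) ∧
    ∀ δ : ℝ, 0 < δ → ∀ A : Set 𝒳, MeasurableSet A → ν A < ENNReal.ofReal δ →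
      ∀ᵐ ω ∂P, (⨆ n : ℕ, condProbMem P X (n + 1) A ω) < ε δ

/-- The asymptotic rate `limsup_N (1/N) ∑_{n=1}^N 1{Z n ∈ A}` at which the path `ω` of the
process `Z` lands in `A` (the averages lie in `[0, 1]`). -/
noncomputable def asymptoticRate {Ω 𝒳 : Type*} (Z : ℕ → Ω → 𝒳) (A : Set 𝒳) (ω : Ω) : ℝ :=
  limsup (fun N : ℕ => (1 / (N : ℝ)) *
    ∑ n ∈ Finset.Icc 1 N, A.indicator (fun _ => (1 : ℝ)) (Z n ω)) atTop

/-- The process `Z` is ergodically dominated by `ν`. -/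
def ErgodicallyDominated {Ω 𝒳 : Type*} [MeasurableSpace Ω] [MeasurableSpace 𝒳]
    (P : Measure Ω) (Z : ℕ → Ω → 𝒳) (ν : Measure 𝒳) : Prop :=
  ∀ e : ℝ, 0 < e → ∃ δ : ℝ, 0 < δ ∧
    ∀ A : Set 𝒳, MeasurableSet A → ν A < ENNReal.ofReal δ →
      ∀ᵐ ω ∂P, asymptoticRate Z A ω < e

/-- `X'` is a nearest neighbor process of `X`: almost surely, for all `n ≥ 1`, `X' n` is one of
`X 0, …, X (n - 1)`, at minimal distance from `X n`. (The value `X' 0` plays no role.) -/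
def IsNearestNeighborProcess {Ω 𝒳 : Type*} [MeasurableSpace Ω] [MetricSpace 𝒳]
    (P : Measure Ω) (X X' : ℕ → Ω → 𝒳) : Prop :=
  ∀ᵐ ω ∂P, ∀ n : ℕ, 1 ≤ n → (∃ m < n, X' n ω = X m ω) ∧
    ∀ j < n, dist (X n ω) (X' n ω) ≤ dist (X n ω) (X j ω)

/-!
Consider the times `n ≤ N` at which the nearest neighbor `X' n` of `X n` lies in `A`, and let `M` be
the number of past visits of `X` to `A` itself, which by uniform domination is at most about
`ε(δ₀) N`. At time `n`, put balls around the past visits to `A`, of the radius `r` for which their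
union has mass less than `δ`; if there are `k` visits then `r ^ d` is of the order `δ / k`.

* Near times, when `X n` falls into one of these balls. The union of the balls is determined by the
  past, so this has conditional probability at most `ε(δ)`, and it happens at most about `ε(δ) N`
  times (`UniformlyDominatedAtRate.ae_eventually_sum_near_le`). Domination is assumed for fixed sets
  only; rounding the centers to a dense sequence leaves countably many possible unions, to which it
  extends (`UniformlyDominatedAtRate.measure_inter_mem_le`). The passage from conditional
  probabilities to frequencies is `ae_eventually_sum_indicator_le`.

* Far times, when `X n` is at distance at least `r` from `X' n`. As `r` decreases with time, it can
  be replaced by its value at time `N`. The far times are sorted by the dyadic scale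
  of the distance (`card_far_nearest_le`). The points `X n` belonging to the same scale `s` are
  mutually separated by about `s`, as a later one has the earlier one among its candidates. Hence,
  by the doubling property, each visit to `A` serves as the nearest neighbor only `O(1)` times at a
  given scale, so that a scale contributes `O(M)`; and a scale contributes at most a packing number,
  `O(s ^ (-d))`. The scales with `s ^ (-d) ≤ M` form a geometric series and contribute `O(M)`
  altogether. As the mass bound has the same exponent `d`, only `O(1 + log⁺ (1 / δ))` scales remain
  down to `r`, where `r ^ d` is of the order `δ / M`. The total is `O(1 + log⁺ (1 / δ)) M`.

The inequality is strict because `ε(δ₀) > 0` and the first constant can be enlarged. If `d < 1` then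
the doubling property leaves only one point, and `X'` visits `A` exactly when `X` does.
-/

/-! ### Coverings and packings -/

/-- Every ball can be covered by at most `K` closed balls of half its radius. For `K = ⌊2 ^ d⌋` this
is the doubling condition with dimension `d`; an integral `K` shows that `d < 1` forces `K ≤ 1`. -/
def HasHalvingCovers (𝒳 : Type*) [MetricSpace 𝒳] (K : ℕ) : Prop :=
  ∀ (x : 𝒳) (r : ℝ), 0 < r → ∃ t : Finset 𝒳, t.card ≤ K ∧
    Metric.ball x r ⊆ ⋃ y ∈ t, Metric.closedBall y (r / 2)

/-- Iterated halving. Between two halvings the closed balls are enlarged to slightly larger open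
balls; the room for this comes from the strict inequality `R / 2 ^ j < ρ`, so that no power of the
covering constant is lost. -/
theorem exists_finset_card_le_pow_ball_subset {𝒳 : Type*} [MetricSpace 𝒳] {K : ℕ}
    (hK : HasHalvingCovers 𝒳 K) (j : ℕ) :
    ∀ (x : 𝒳) (R ρ : ℝ), 0 < R → R / 2 ^ j < ρ →
      ∃ t : Finset 𝒳, t.card ≤ K ^ j ∧ Metric.ball x R ⊆ ⋃ y ∈ t, Metric.ball y ρ := by
  classical
  induction j with
  | zero =>
    intro x R ρ _ h
    refine ⟨{x}, by simp, ?_⟩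
    simpa using Metric.ball_subset_ball (by simpa using h.le)
  | succ j ih =>
    intro x R ρ hR h
    have h' : R / 2 < ρ * 2 ^ j := by
      rw [pow_succ, div_lt_iff₀ (by positivity)] at h
      linarith
    obtain ⟨R', hR1, hR2⟩ := exists_between h'
    obtain ⟨t, htc, ht⟩ := hK x R hR
    have hcov : ∀ y : 𝒳, ∃ s : Finset 𝒳, s.card ≤ K ^ j ∧
        Metric.ball y R' ⊆ ⋃ z ∈ s, Metric.ball z ρ := fun y =>
      ih y R' ρ (by linarith) (by rwa [div_lt_iff₀ (by positivity)])
    choose s hsc hs using hcov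
    refine ⟨t.biUnion s, ?_, ?_⟩
    · calc (t.biUnion s).card ≤ t.card * K ^ j :=
            Finset.card_biUnion_le_card_mul _ _ _ fun y _ => hsc y
        _ ≤ K * K ^ j := Nat.mul_le_mul_right _ htc
        _ = K ^ (j + 1) := by ring
    · intro z hz
      have h1 := ht hz
      simp only [Set.mem_iUnion] at h1
      obtain ⟨y, hy, hzy⟩ := h1
      have h2 := hs y (Metric.closedBall_subset_ball hR1 hzy)
      simp only [Set.mem_iUnion] at h2 ⊢
      obtain ⟨w, hw, hzw⟩ := h2
      exact ⟨w, Finset.mem_biUnion.2 ⟨y, hy, hw⟩, hzw⟩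

theorem card_le_pow_of_separated {𝒳 : Type*} [MetricSpace 𝒳] {K : ℕ}
    (hK : HasHalvingCovers 𝒳 K)
    {ι : Type*} (S : Finset ι) (f : ι → 𝒳) {x : 𝒳} {R s : ℝ} (hR : 0 < R) {j : ℕ}
    (hj : R / 2 ^ j < s / 2) (hf : ∀ i ∈ S, f i ∈ Metric.ball x R)
    (hsep : ∀ i ∈ S, ∀ i' ∈ S, i ≠ i' → s ≤ dist (f i) (f i')) : S.card ≤ K ^ j := by
  obtain ⟨t, htc, ht⟩ := exists_finset_card_le_pow_ball_subset hK j x R (s / 2) hR hj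
  have h : ∀ i, ∃ y, i ∈ S → y ∈ t ∧ f i ∈ Metric.ball y (s / 2) := by
    intro i
    by_cases hi : i ∈ S
    · have := ht (hf i hi)
      simp only [Set.mem_iUnion] at this
      obtain ⟨y, hy, h⟩ := this
      exact ⟨y, fun _ => ⟨hy, h⟩⟩
    · exact ⟨x, fun h => absurd h hi⟩
  choose g hg using h
  refine (Finset.card_le_card_of_injOn g (fun i hi => (hg i hi).1) ?_).trans htc
  intro i hi i' hi' hii
  by_contra hne
  have h1 := (hg i hi).2
  have h2 := (hg i' hi').2
  rw [← hii, Metric.mem_ball] at h2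
  rw [Metric.mem_ball] at h1
  have := dist_triangle_right (f i) (f i') (g i)
  linarith [hsep i hi i' hi' hne]

theorem subsingleton_of_halving_by_one {𝒳 : Type*} [MetricSpace 𝒳]
    (hK : HasHalvingCovers 𝒳 1) : Subsingleton 𝒳 := by
  refine ⟨fun x y => ?_⟩
  by_contra hne
  have hd : 0 < dist x y := dist_pos.2 hne
  have h := card_le_pow_of_separated hK (Finset.univ : Finset (Fin 2)) ![x, y] (x := x)
    (R := 2 * dist x y) (s := dist x y) (j := 3) (by positivity) (by norm_num; linarith)
    (by
      intro i _
      fin_cases i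
      · simp [hne]
      · simp only [Fin.mk_one, Matrix.cons_val_one, Matrix.cons_val_fin_one, Metric.mem_ball]
        rw [dist_comm]; linarith)
    (by
      intro i _ i' _ hii
      fin_cases i <;> fin_cases i' <;> simp_all [dist_comm])
  simp at h

/-! ### Nearest neighbors at a given scale -/

/-- The sample paths of a nearest neighbor process: for `n ≥ 1`, the point `x' n` is one of
`x 0, …, x (n - 1)`, at minimal distance from `x n`. -/
def IsNearestNeighborSeq {𝒳 : Type*} [MetricSpace 𝒳] (x x' : ℕ → 𝒳) : Prop :=
  ∀ n, 1 ≤ n → (∃ m < n, x' n = x m) ∧ ∀ j < n, dist (x n) (x' n) ≤ dist (x n) (x j)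

/-- Later points of a nearest neighbor sequence stay away from earlier ones. -/
theorem le_dist_of_nearest {𝒳 : Type*} [MetricSpace 𝒳] {x x' : ℕ → 𝒳}
    (hNN : IsNearestNeighborSeq x x')
    {s : ℝ} {n n' : ℕ} (hn : 1 ≤ n) (hn' : 1 ≤ n') (hs : s ≤ dist (x n) (x' n))
    (hs' : s ≤ dist (x n') (x' n')) (hne : n ≠ n') : s ≤ dist (x n) (x n') := by
  rcases lt_or_gt_of_ne hne with h | h
  · rw [dist_comm]
    exact hs'.trans ((hNN n' hn').2 n h)
  · exact hs.trans ((hNN n hn).2 n' h)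

open scoped Classical in
/-- The times `n ∈ [1, N]` at which the nearest neighbor `x' n` lies in `A`, at a distance from
`x n` of dyadic scale `D / 2 ^ j`. -/
noncomputable def scaleTimes {𝒳 : Type*} [MetricSpace 𝒳] (x x' : ℕ → 𝒳) (A : Set 𝒳) (D : ℝ)
    (N j : ℕ) : Finset ℕ :=
  (Finset.Icc 1 N).filter fun n => x' n ∈ A ∧ D / 2 ^ (j + 1) ≤ dist (x n) (x' n) ∧
    dist (x n) (x' n) ≤ D / 2 ^ j

open scoped Classical in
/-- The number of visits of `x` to `A` at the times `0, …, N - 1`. -/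
noncomputable def visits {𝒳 : Type*} (x : ℕ → 𝒳) (A : Set 𝒳) (N : ℕ) : Finset ℕ :=
  (Finset.range N).filter fun m => x m ∈ A

section
variable {𝒳 : Type*} [MetricSpace 𝒳] {K : ℕ} {x x' : ℕ → 𝒳} {A : Set 𝒳} {D : ℝ}

/-- At a single scale, a given point can be the nearest neighbor only boundedly often. -/
theorem card_scaleTimes_le_mul_visits
    (hK : HasHalvingCovers 𝒳 K)
    (hNN : IsNearestNeighborSeq x x')
    (hD : 0 < D) (N j : ℕ) :
    (scaleTimes x x' A D N j).card ≤ K ^ 4 * (visits x A N).card := by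
  classical
  have h : ∀ n, ∃ m, 1 ≤ n → m < n ∧ x' n = x m := by
    intro n
    by_cases hn : 1 ≤ n
    · obtain ⟨m, hm⟩ := (hNN n hn).1
      exact ⟨m, fun _ => hm⟩
    · exact ⟨0, fun h => absurd h hn⟩
  choose f hf using h
  refine Finset.card_le_mul_card_image_of_maps_to (f := f) ?_ _ ?_
  · intro n hn
    simp only [scaleTimes, Finset.mem_filter, Finset.mem_Icc] at hn
    obtain ⟨h1, h2⟩ := hf n hn.1.1
    simp only [visits, Finset.mem_filter, Finset.mem_range]
    exact ⟨by omega, h2 ▸ hn.2.1⟩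
  · intro m _
    have hs : 0 < D / 2 ^ j := by positivity
    refine card_le_pow_of_separated hK _ x (x := x m) (R := 5 / 4 * (D / 2 ^ j))
      (s := D / 2 ^ (j + 1)) (by positivity) (by rw [pow_succ 2 j, ← div_div]; linarith) ?_ ?_
    · intro n hn
      simp only [scaleTimes, Finset.mem_filter, Finset.mem_Icc] at hn
      have h2 := (hf n hn.1.1.1).2
      rw [hn.2] at h2
      rw [Metric.mem_ball, ← h2]
      linarith [hn.1.2.2.2]
    · intro n hn n' hn' hne
      simp only [scaleTimes, Finset.mem_filter, Finset.mem_Icc] at hn hn'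
      exact le_dist_of_nearest hNN hn.1.1.1 hn'.1.1.1 hn.1.2.2.1 hn'.1.2.2.1 hne

theorem card_scaleTimes_le_pow
    (hK : HasHalvingCovers 𝒳 K)
    (hNN : IsNearestNeighborSeq x x')
    (hD : 0 < D) (hdist : ∀ y z : 𝒳, dist y z ≤ D) (N j : ℕ) :
    (scaleTimes x x' A D N j).card ≤ K ^ (j + 4) := by
  have hs : 0 < D / 2 ^ j := by positivity
  refine card_le_pow_of_separated hK _ x (x := x 0) (R := 5 / 4 * D)
    (s := D / 2 ^ (j + 1)) (by positivity) ?_ ?_ ?_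
  · rw [pow_succ 2 j, pow_add 2 j, ← div_div, ← div_div, mul_div_assoc]
    linarith
  · intro n _
    rw [Metric.mem_ball]
    linarith [hdist (x n) (x 0)]
  · intro n hn n' hn' hne
    simp only [scaleTimes, Finset.mem_filter, Finset.mem_Icc] at hn hn'
    exact le_dist_of_nearest hNN hn.1.1 hn'.1.1 hn.2.2.1 hn'.2.2.1 hne

end

/-! ### Summation over the scales -/

theorem sum_range_ite_pow_le {b M : ℝ} (hb : 2 ≤ b) (j₀ n : ℕ) :
    ∑ j ∈ Finset.range n, (if j < j₀ then b ^ j else M) ≤ b ^ min n j₀ + ((n - j₀ : ℕ) : ℝ) * M := by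
  induction n with
  | zero => simp
  | succ n ih =>
    rw [Finset.sum_range_succ]
    by_cases h : n < j₀
    · rw [min_eq_left h.le, Nat.sub_eq_zero_of_le h.le] at ih
      rw [if_pos h, min_eq_left (by omega : n + 1 ≤ j₀), Nat.sub_eq_zero_of_le (by omega : n + 1 ≤ j₀),
        pow_succ]
      have : 0 < b ^ n := by positivity
      simp only [Nat.cast_zero, zero_mul, add_zero] at *
      nlinarith
    · push Not at h
      rw [min_eq_right h] at ih
      rw [if_neg (by omega), min_eq_right (by omega : j₀ ≤ n + 1), Nat.succ_sub h]
      push_cast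
      linarith

/-- A sum of terms bounded both by a geometric progression and by a constant `M`: the terms before
the crossover add up to about `M`, and only those after it have to be counted. -/
theorem sum_le_of_le_pow_of_le {b M Q : ℝ} (hb : 2 ≤ b) (hM : 1 ≤ M) (hQ : 0 < Q) {J : ℕ}
    (hJ : b ^ J ≤ Q * M) {e : ℕ → ℝ} (h1 : ∀ j, e j ≤ b ^ (j + 4)) (h2 : ∀ j, e j ≤ b ^ 4 * M) :
    ∑ j ∈ Finset.range (J + 1), e j ≤ b ^ 4 * (3 + Real.posLog Q / Real.log 2) * M := by
  obtain ⟨j₀, hj1, hj2⟩ := exists_nat_pow_near hM (by linarith : 1 < b)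
  have hb4 : 0 < b ^ 4 := by positivity
  have hlog2 : 0 < Real.log 2 := Real.log_pos (by norm_num)
  have hstep : ∑ j ∈ Finset.range (J + 1), e j ≤
      b ^ 4 * ∑ j ∈ Finset.range (J + 1), (if j < j₀ then b ^ j else M) := by
    rw [Finset.mul_sum]
    refine Finset.sum_le_sum fun j _ => ?_
    split_ifs
    · rw [← pow_add, add_comm]; exact h1 j
    · exact h2 j
  have hmin : b ^ min (J + 1) j₀ ≤ M :=
    (pow_le_pow_right₀ (by linarith) (min_le_right _ _)).trans hj1
  have hcount : ((J + 1 - j₀ : ℕ) : ℝ) ≤ 2 + Real.posLog Q / Real.log 2 := by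
    have hpos : 0 ≤ Real.posLog Q / Real.log 2 := div_nonneg Real.posLog_nonneg hlog2.le
    by_cases h : J ≤ j₀ + 1
    · have : ((J + 1 - j₀ : ℕ) : ℝ) ≤ (2 : ℕ) := by
        exact_mod_cast (by omega : J + 1 - j₀ ≤ 2)
      push_cast at this
      linarith
    · push Not at h
      obtain ⟨i, rfl⟩ := Nat.exists_eq_add_of_lt h
      have e1 : j₀ + 1 + i + 1 + 1 - j₀ = i + 3 := by omega
      rw [e1]
      have hbi : (2 : ℝ) ^ (i + 1) ≤ Q := by
        have hlt : b ^ (j₀ + 1) * b ^ (i + 1) ≤ b ^ (j₀ + 1) * Q := by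
          rw [← pow_add, ← add_assoc, mul_comm _ Q]
          exact hJ.trans (mul_le_mul_of_nonneg_left hj2.le hQ.le)
        exact (pow_le_pow_left₀ (by norm_num) hb _).trans
          (le_of_mul_le_mul_left hlt (by positivity))
      have hl : ((i + 1 : ℕ) : ℝ) * Real.log 2 ≤ Real.posLog Q := by
        rw [← Real.log_pow]
        exact (Real.log_le_log (by positivity) hbi).trans (le_max_right _ _)
      have := (le_div_iff₀ hlog2).2 hl
      push_cast at this ⊢
      linarith
  calc _ ≤ b ^ 4 * (M + (2 + Real.posLog Q / Real.log 2) * M) := by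
        refine hstep.trans (mul_le_mul_of_nonneg_left ?_ hb4.le)
        refine (sum_range_ite_pow_le hb j₀ (J + 1)).trans (add_le_add hmin ?_)
        exact mul_le_mul_of_nonneg_right hcount (by linarith)
    _ = _ := by ring

open scoped Classical in
/-- The pathwise estimate. Up to time `N`, the nearest neighbor lies in `A` at distance at least
`r` only `O(log Q)` times per visit to `A`, where `Q` compares `(D / r) ^ d`, the order of the
number of `r`-separated points, with the number of visits. -/
theorem card_far_nearest_le {𝒳 : Type*} [MetricSpace 𝒳] {K : ℕ}
    (hK : HasHalvingCovers 𝒳 K)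
    {x x' : ℕ → 𝒳} {A : Set 𝒳} {D d r Q : ℝ}
    (hNN : IsNearestNeighborSeq x x')
    (hD : 0 < D) (hdist : ∀ y z : 𝒳, dist y z ≤ D) (hd : 1 ≤ d) (hKd : (K : ℝ) ≤ 2 ^ d)
    (hr : 0 < r) (hQ : 0 < Q) (N : ℕ) (hM : 0 < (visits x A N).card)
    (hrQ : (D / r) ^ d ≤ Q * (visits x A N).card) :
    (((Finset.Icc 1 N).filter fun n => x' n ∈ A ∧ r ≤ dist (x n) (x' n)).card : ℝ) ≤
      ((2 : ℝ) ^ d) ^ 4 * (3 + Real.posLog Q / Real.log 2) * (visits x A N).card := by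
  have hb : (2 : ℝ) ≤ 2 ^ d := by
    simpa using Real.rpow_le_rpow_of_exponent_le (by norm_num : (1 : ℝ) ≤ 2) hd
  have hM1 : (1 : ℝ) ≤ (visits x A N).card := by exact_mod_cast hM
  rcases lt_or_ge D r with hDr | hDr
  · rw [Finset.filter_false_of_mem fun n _ h => by linarith [h.2, hdist (x n) (x' n)]]
    have : 0 ≤ Real.posLog Q / Real.log 2 :=
      div_nonneg Real.posLog_nonneg (Real.log_nonneg (by norm_num))
    simp only [Finset.card_empty, Nat.cast_zero]
    positivity
  obtain ⟨J, hJ1, hJ2⟩ := exists_nat_pow_near ((one_le_div hr).2 hDr) (by norm_num : (1 : ℝ) < 2)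
  have hsub : ((Finset.Icc 1 N).filter fun n => x' n ∈ A ∧ r ≤ dist (x n) (x' n)) ⊆
      (Finset.range (J + 1)).biUnion fun j => scaleTimes x x' A D N j := by
    intro n hn
    obtain ⟨hn1, hn2, hn3⟩ := Finset.mem_filter.1 hn
    have hpos : 0 < dist (x n) (x' n) := hr.trans_le hn3
    obtain ⟨j, hj1, hj2⟩ := exists_nat_pow_near
      ((one_le_div hpos).2 (hdist (x n) (x' n))) (by norm_num : (1 : ℝ) < 2)
    have hjJ : j < J + 1 := by
      have : (2 : ℝ) ^ j < 2 ^ (J + 1) :=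
        (hj1.trans (div_le_div_of_nonneg_left hD.le hr hn3)).trans_lt hJ2
      exact (pow_lt_pow_iff_right₀ (by norm_num)).1 this
    refine Finset.mem_biUnion.2 ⟨j, Finset.mem_range.2 hjJ, ?_⟩
    refine Finset.mem_filter.2 ⟨hn1, hn2, ?_, ?_⟩
    · rw [div_lt_iff₀ hpos] at hj2
      rw [div_le_iff₀ (by positivity)]
      linarith
    · rw [le_div_iff₀ hpos] at hj1
      rw [le_div_iff₀ (by positivity)]
      linarith
  have hJb : ((2 : ℝ) ^ d) ^ J ≤ Q * (visits x A N).card := by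
    refine le_trans ?_ hrQ
    rw [← Real.rpow_natCast, ← Real.rpow_mul (by norm_num), mul_comm d, Real.rpow_mul (by norm_num),
      Real.rpow_natCast]
    exact Real.rpow_le_rpow (by positivity) hJ1 (by linarith)
  have hsum := sum_le_of_le_pow_of_le hb hM1 hQ hJb
    (e := fun j => ((scaleTimes x x' A D N j).card : ℝ))
    (fun j => by
      have h := card_scaleTimes_le_pow (A := A) hK hNN hD hdist N j
      calc ((scaleTimes x x' A D N j).card : ℝ) ≤ (K : ℝ) ^ (j + 4) := by exact_mod_cast h
        _ ≤ _ := pow_le_pow_left₀ (by positivity) hKd _)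
    (fun j => by
      have h := card_scaleTimes_le_mul_visits (A := A) hK hNN hD N j
      calc ((scaleTimes x x' A D N j).card : ℝ) ≤ (K : ℝ) ^ 4 * (visits x A N).card := by
            exact_mod_cast h
        _ ≤ _ := mul_le_mul_of_nonneg_right (pow_le_pow_left₀ (by positivity) hKd _)
            (by positivity))
  refine le_trans ?_ hsum
  exact_mod_cast (Finset.card_le_card hsub).trans Finset.card_biUnion_le

/-! ### Frequencies of events of small conditional probability -/

section
variable {Ω : Type*} {m0 : MeasurableSpace Ω} {P : Measure Ω}

theorem setLIntegral_le_of_forall_measure_inter_le {F : MeasurableSpace Ω} (hF : F ≤ m0)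
    {E : Set Ω} {q : ENNReal} (hE : ∀ B, MeasurableSet[F] B → P (B ∩ E) ≤ q * P B)
    {f : Ω → ENNReal} (hf : Measurable[F] f) : ∫⁻ ω in E, f ω ∂P ≤ q * ∫⁻ ω, f ω ∂P := by
  rw [← lintegral_trim hF hf, ← lintegral_trim hF hf, ← smul_eq_mul,
    ← lintegral_smul_measure]
  refine lintegral_mono' (Measure.le_iff.2 fun B hB => ?_) le_rfl
  rw [trim_measurableSet_eq hF hB, Measure.restrict_apply (hF _ hB), Measure.smul_apply,
    trim_measurableSet_eq hF hB]
  exact hE B hB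

/-- Exponential moments of the counting process of events of conditional probability at most
`p`. -/
theorem lintegral_exp_sum_indicator_le [IsProbabilityMeasure P] {F : ℕ → MeasurableSpace Ω}
    (hF : ∀ n, F n ≤ m0) (hmono : Monotone F) {E : ℕ → Set Ω}
    (hE : ∀ n, 1 ≤ n → MeasurableSet[F (n + 1)] (E n)) {p : ℝ} (hp : 0 ≤ p)
    (hEp : ∀ n, 1 ≤ n → ∀ B, MeasurableSet[F n] B → P (B ∩ E n) ≤ ENNReal.ofReal p * P B)
    {t : ℝ} (ht : 0 ≤ t) (N : ℕ) :
    ∫⁻ ω, ENNReal.ofReal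
        (Real.exp (t * ∑ n ∈ Finset.Icc 1 N, (E n).indicator (fun _ => (1 : ℝ)) ω)) ∂P ≤
      ENNReal.ofReal ((1 + p * (Real.exp t - 1)) ^ N) := by
  have het : 0 ≤ Real.exp t - 1 := by linarith [Real.one_le_exp ht]
  have hmeas : ∀ N : ℕ, Measurable[F (N + 1)] fun ω => ENNReal.ofReal
      (Real.exp (t * ∑ n ∈ Finset.Icc 1 N, (E n).indicator (fun _ => (1 : ℝ)) ω)) := by
    intro N
    have : Measurable[F (N + 1)] fun ω =>
        ∑ n ∈ Finset.Icc 1 N, (E n).indicator (fun _ => (1 : ℝ)) ω := by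
      refine Finset.measurable_sum _ fun n hn => ?_
      obtain ⟨h1, h2⟩ := Finset.mem_Icc.1 hn
      exact measurable_const.indicator (hmono (by omega : n + 1 ≤ N + 1) _ (hE n h1))
    exact ENNReal.measurable_ofReal.comp (Real.measurable_exp.comp (this.const_mul t))
  induction N with
  | zero => simp
  | succ N ih =>
    set W : Ω → ENNReal := fun ω => ENNReal.ofReal
      (Real.exp (t * ∑ n ∈ Finset.Icc 1 N, (E n).indicator (fun _ => (1 : ℝ)) ω)) with hW
    have hEm : MeasurableSet (E (N + 1)) := hF _ _ (hE (N + 1) (by omega))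
    have hstep : ∀ ω, ENNReal.ofReal (Real.exp
        (t * ∑ n ∈ Finset.Icc 1 (N + 1), (E n).indicator (fun _ => (1 : ℝ)) ω)) =
        W ω + ENNReal.ofReal (Real.exp t - 1) * (E (N + 1)).indicator W ω := by
      intro ω
      rw [Finset.sum_Icc_succ_top (by omega : 1 ≤ N + 1), mul_add, Real.exp_add]
      by_cases h : ω ∈ E (N + 1)
      · simp only [Set.indicator_of_mem h, hW]
        rw [← ENNReal.ofReal_mul het, ← ENNReal.ofReal_add (by positivity) (by positivity)]
        congr 1
        ring_nf
      · simp [Set.indicator_of_notMem h, hW]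
    have hWm : Measurable W := (hmeas N).mono (hF _) le_rfl
    calc _ = ∫⁻ ω, W ω + ENNReal.ofReal (Real.exp t - 1) * (E (N + 1)).indicator W ω ∂P :=
          lintegral_congr hstep
      _ = ∫⁻ ω, W ω ∂P + ENNReal.ofReal (Real.exp t - 1) * ∫⁻ ω in E (N + 1), W ω ∂P := by
          rw [lintegral_add_left hWm, lintegral_const_mul _ (hWm.indicator hEm),
            lintegral_indicator hEm]
      _ ≤ ∫⁻ ω, W ω ∂P + ENNReal.ofReal (Real.exp t - 1) *
            (ENNReal.ofReal p * ∫⁻ ω, W ω ∂P) := by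
          gcongr
          exact setLIntegral_le_of_forall_measure_inter_le (hF _) (hEp (N + 1) (by omega)) (hmeas N)
      _ = ENNReal.ofReal (1 + p * (Real.exp t - 1)) * ∫⁻ ω, W ω ∂P := by
          rw [ENNReal.ofReal_add zero_le_one (by positivity), ENNReal.ofReal_mul hp,
            ENNReal.ofReal_one]
          ring
      _ ≤ ENNReal.ofReal (1 + p * (Real.exp t - 1)) *
            ENNReal.ofReal ((1 + p * (Real.exp t - 1)) ^ N) := by gcongr
      _ = _ := by rw [← ENNReal.ofReal_mul (by positivity), pow_succ']

/-- One half of a strong law of large numbers, by Chernoff's bound and the Borel–Cantelli lemma: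
events of conditional probability at most `p` given the past occur with asymptotic frequency at
most `p`. -/
theorem ae_eventually_sum_indicator_le [IsProbabilityMeasure P] {F : ℕ → MeasurableSpace Ω}
    (hF : ∀ n, F n ≤ m0) (hmono : Monotone F) {E : ℕ → Set Ω}
    (hE : ∀ n, 1 ≤ n → MeasurableSet[F (n + 1)] (E n)) {p : ℝ} (hp : 0 < p)
    (hEp : ∀ n, 1 ≤ n → ∀ B, MeasurableSet[F n] B → P (B ∩ E n) ≤ ENNReal.ofReal p * P B)
    {η : ℝ} (hη : 0 < η) :
    ∀ᵐ ω ∂P, ∀ᶠ N : ℕ in atTop,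
      ∑ n ∈ Finset.Icc 1 N, (E n).indicator (fun _ => (1 : ℝ)) ω ≤ (p + η) * N := by
  -- The exponent `t = log a` makes the Chernoff rate `ρ` less than one as soon as `a * p < p + η`.
  set a : ℝ := 1 + η / (2 * p) with ha
  have ha1 : 1 < a := by rw [ha]; linarith [div_pos hη (by positivity : 0 < 2 * p)]
  have hap : a * p = p + η / 2 := by rw [ha]; field_simp
  set t : ℝ := Real.log a with ht
  have ht0 : 0 < t := Real.log_pos ha1
  have hexp : Real.exp t = a := Real.exp_log (by linarith)
  set ρ : ℝ := (1 + p * (a - 1)) / Real.exp (t * (p + η)) with hρ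
  have hnum : 0 < 1 + p * (a - 1) := by nlinarith
  have hρ0 : 0 ≤ ρ := by positivity
  have hρ1 : ρ < 1 := by
    rw [hρ, div_lt_one (Real.exp_pos _)]
    have h1 : 1 + p * (a - 1) ≤ Real.exp (p * (a - 1)) := by
      linarith [Real.add_one_le_exp (p * (a - 1))]
    refine h1.trans_lt (Real.exp_lt_exp.2 ?_)
    have h2 : 1 - a⁻¹ ≤ t := Real.one_sub_inv_le_log_of_pos (by linarith)
    have h3 : (1 - a⁻¹) * a = a - 1 := by field_simp
    have h4 : 0 < 1 - a⁻¹ := by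
      have := inv_lt_one_of_one_lt₀ ha1
      linarith
    calc p * (a - 1) = (1 - a⁻¹) * (a * p) := by rw [← h3]; ring
      _ < (1 - a⁻¹) * (p + η) := by
        refine mul_lt_mul_of_pos_left ?_ h4
        linarith
      _ ≤ t * (p + η) := mul_le_mul_of_nonneg_right h2 (by linarith)
  set s : ℕ → Ω → ℝ := fun N ω => ∑ n ∈ Finset.Icc 1 N, (E n).indicator (fun _ => (1 : ℝ)) ω with hs
  have hbound : ∀ N : ℕ, P {ω | (p + η) * N < s N ω} ≤ ENNReal.ofReal (ρ ^ N) := by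
    intro N
    have hmgf := lintegral_exp_sum_indicator_le hF hmono hE hp.le hEp ht0.le N
    rw [hexp] at hmgf
    have hsm : Measurable (s N) := by
      refine Finset.measurable_sum _ fun n hn => ?_
      exact measurable_const.indicator (hF _ _ (hE n (Finset.mem_Icc.1 hn).1))
    have hmarkov := mul_meas_ge_le_lintegral (μ := P)
      (f := fun ω => ENNReal.ofReal (Real.exp (t * s N ω)))
      (ENNReal.measurable_ofReal.comp (Real.measurable_exp.comp (hsm.const_mul t)))
      (ENNReal.ofReal (Real.exp (t * (p + η)) ^ N))
    have hsub : {ω | (p + η) * N < s N ω} ⊆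
        {ω | ENNReal.ofReal (Real.exp (t * (p + η)) ^ N) ≤
          ENNReal.ofReal (Real.exp (t * s N ω))} := by
      intro ω hω
      refine ENNReal.ofReal_le_ofReal ?_
      rw [← Real.exp_nat_mul]
      refine Real.exp_le_exp.2 ?_
      have : (p + η) * N ≤ s N ω := le_of_lt hω
      nlinarith
    have hpos : 0 < Real.exp (t * (p + η)) ^ N := by positivity
    rw [hρ, div_pow, ENNReal.ofReal_div_of_pos hpos]
    refine ENNReal.le_div_iff_mul_le (Or.inl (by simpa using hpos)) (Or.inl ENNReal.ofReal_ne_top)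
      |>.2 ?_
    rw [mul_comm]
    calc _ ≤ _ := mul_le_mul_right (measure_mono hsub) _
      _ ≤ _ := hmarkov.trans hmgf
  have hsum : ∑' N, P {ω | (p + η) * N < s N ω} ≠ ⊤ := by
    refine ne_top_of_le_ne_top ?_ (ENNReal.tsum_le_tsum hbound)
    exact (summable_geometric_of_lt_one hρ0 hρ1).tsum_ofReal_ne_top
  filter_upwards [ae_eventually_notMem hsum] with ω hω
  filter_upwards [hω] with N hN
  simpa using hN

end

/-! ### Domination of random sets determined by the past -/

theorem measurable_pastSigma {Ω 𝒳 : Type*} [MeasurableSpace 𝒳] {X : ℕ → Ω → 𝒳} {m n : ℕ}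
    (h : m < n) : Measurable[pastSigma X n] (X m) :=
  measurable_iff_comap_le.2 (le_iSup (fun i : Fin n => MeasurableSpace.comap (X i) inferInstance)
    ⟨m, h⟩)

theorem monotone_pastSigma {Ω 𝒳 : Type*} [MeasurableSpace 𝒳] {X : ℕ → Ω → 𝒳} :
    Monotone (pastSigma X) := fun _ _ hmn =>
  iSup_le fun i => measurable_iff_comap_le.1 (measurable_pastSigma (i.2.trans_le hmn))

theorem measurableSet_pastSigma_succ_setOf_mem {Ω 𝒳 : Type*} [MeasurableSpace 𝒳]
    {X : ℕ → Ω → 𝒳} {ι : Type*} [Countable ι] {S : ι → Set 𝒳}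
    (hS : ∀ i, MeasurableSet (S i)) {n : ℕ} {φ : Ω → ι}
    (hφ : ∀ i, MeasurableSet[pastSigma X n] (φ ⁻¹' {i})) :
    MeasurableSet[pastSigma X (n + 1)] {ω | X n ω ∈ S (φ ω)} := by
  have heq : {ω | X n ω ∈ S (φ ω)} = ⋃ i, φ ⁻¹' {i} ∩ X n ⁻¹' S i := by
    ext ω
    simp
  rw [heq]
  exact MeasurableSet.iUnion fun i =>
    (monotone_pastSigma (by omega : n ≤ n + 1) _ (hφ i)).inter
      (measurable_pastSigma (by omega : n < n + 1) (hS i))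

section
variable {Ω 𝒳 : Type*} [MeasurableSpace Ω] [MeasurableSpace 𝒳] {P : Measure Ω} {X : ℕ → Ω → 𝒳}

theorem pastSigma_le (hX : ∀ n, Measurable (X n)) (n : ℕ) : pastSigma X n ≤ ‹MeasurableSpace Ω› :=
  iSup_le fun i => (hX i).comap_le

/-- The rate is positive, since it bounds the probability of the empty set strictly. -/
theorem UniformlyDominatedAtRate.pos [IsProbabilityMeasure P] {ν : Measure 𝒳} {ε : ℝ → ℝ}
    (h : UniformlyDominatedAtRate P X ν ε) {δ : ℝ} (hδ : 0 < δ) : 0 < ε δ := by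
  have h1 := h.2 δ hδ ∅ MeasurableSet.empty (by simpa using hδ)
  have h2 : ∀ n, condProbMem P X n ∅ = 0 := by
    intro n
    simp only [condProbMem, Set.preimage_empty, Set.indicator_empty]
    exact condExp_zero
  simpa [h2] using h1

theorem UniformlyDominatedAtRate.measure_inter_preimage_le [IsProbabilityMeasure P]
    {ν : Measure 𝒳} {ε : ℝ → ℝ} (h : UniformlyDominatedAtRate P X ν ε)
    (hX : ∀ n, Measurable (X n)) {δ : ℝ} (hδ : 0 < δ) {A : Set 𝒳} (hA : MeasurableSet A)
    (hνA : ν A < ENNReal.ofReal δ) {n : ℕ} (hn : 1 ≤ n) {B : Set Ω}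
    (hB : MeasurableSet[pastSigma X n] B) :
    P (B ∩ X n ⁻¹' A) ≤ ENNReal.ofReal (ε δ) * P B := by
  have hle := pastSigma_le hX
  have hint : ∀ k, Integrable ((X k ⁻¹' A).indicator (fun _ => (1 : ℝ))) P := fun k =>
    (integrable_const _).indicator (hX k hA)
  -- Boundedness is what makes the real supremum in the hypothesis an actual supremum.
  have hone : ∀ᵐ ω ∂P, ∀ k, condProbMem P X (k + 1) A ω ≤ 1 := by
    refine ae_all_iff.2 fun k => ?_
    have h1 : condProbMem P X (k + 1) A ≤ᵐ[P] P[fun _ => (1 : ℝ) | pastSigma X (k + 1)] :=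
      condExp_mono (hint _) (integrable_const _)
        (Eventually.of_forall fun ω => Set.indicator_le_self' (fun _ _ => zero_le_one) ω)
    rw [condExp_const (hle _)] at h1
    exact h1
  obtain ⟨k, rfl⟩ : ∃ k, n = k + 1 := ⟨n - 1, by omega⟩
  have hlt : ∀ᵐ ω ∂P, condProbMem P X (k + 1) A ω ≤ ε δ := by
    filter_upwards [h.2 δ hδ A hA hνA, hone] with ω h1 h2
    exact (le_ciSup (f := fun i => condProbMem P X (i + 1) A ω)
      ⟨1, Set.forall_mem_range.2 h2⟩ k).trans h1.le
  have hreal : P.real (B ∩ X (k + 1) ⁻¹' A) ≤ ε δ * P.real B := by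
    calc P.real (B ∩ X (k + 1) ⁻¹' A)
        = ∫ ω in B, (X (k + 1) ⁻¹' A).indicator (fun _ => (1 : ℝ)) ω ∂P := by
          rw [setIntegral_indicator (hX _ hA)]
          simp
      _ = ∫ ω in B, condProbMem P X (k + 1) A ω ∂P :=
          (setIntegral_condExp (hle _) (hint _) hB).symm
      _ ≤ ∫ _ω in B, ε δ ∂P := by
          refine setIntegral_mono_ae integrable_condExp.integrableOn
            (integrable_const _).integrableOn hlt
      _ = ε δ * P.real B := by simp [mul_comm]
  have hε := (h.pos hδ).le
  calc P (B ∩ X (k + 1) ⁻¹' A) = ENNReal.ofReal (P.real (B ∩ X (k + 1) ⁻¹' A)) := by simp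
    _ ≤ ENNReal.ofReal (ε δ * P.real B) := ENNReal.ofReal_le_ofReal hreal
    _ = _ := by rw [ENNReal.ofReal_mul hε]; simp

/-- Uniform domination extends to random sets that are determined by the past, as long as they take
countably many values: it then holds separately on each of the events on which the set is
constant. -/
theorem UniformlyDominatedAtRate.measure_inter_mem_le [IsProbabilityMeasure P]
    {ν : Measure 𝒳} {ε : ℝ → ℝ} (h : UniformlyDominatedAtRate P X ν ε)
    (hX : ∀ n, Measurable (X n)) {δ : ℝ} (hδ : 0 < δ) {ι : Type*} [Countable ι] {S : ι → Set 𝒳}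
    (hS : ∀ i, MeasurableSet (S i)) (hνS : ∀ i, ν (S i) < ENNReal.ofReal δ) {n : ℕ} (hn : 1 ≤ n)
    {φ : Ω → ι} (hφ : ∀ i, MeasurableSet[pastSigma X n] (φ ⁻¹' {i})) {B : Set Ω}
    (hB : MeasurableSet[pastSigma X n] B) :
    P (B ∩ {ω | X n ω ∈ S (φ ω)}) ≤ ENNReal.ofReal (ε δ) * P B := by
  have hle := pastSigma_le hX n
  have hcover : B ∩ {ω | X n ω ∈ S (φ ω)} ⊆ ⋃ i, (B ∩ φ ⁻¹' {i}) ∩ X n ⁻¹' S i := fun ω hω =>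
    Set.mem_iUnion.2 ⟨φ ω, ⟨hω.1, rfl⟩, hω.2⟩
  have hBsum : P B = ∑' i, P (B ∩ φ ⁻¹' {i}) := by
    rw [← measure_iUnion]
    · congr 1
      ext ω
      simp
    · intro i i' hii
      refine Set.disjoint_left.2 fun ω h1 h2 => hii ?_
      exact h1.2.symm.trans h2.2
    · exact fun i => hle _ (hB.inter (hφ i))
  calc _ ≤ ∑' i, P ((B ∩ φ ⁻¹' {i}) ∩ X n ⁻¹' S i) :=
        (measure_mono hcover).trans (measure_iUnion_le _)
    _ ≤ ∑' i, ENNReal.ofReal (ε δ) * P (B ∩ φ ⁻¹' {i}) := ENNReal.tsum_le_tsum fun i =>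
        h.measure_inter_preimage_le hX hδ (hS i) (hνS i) hn (hB.inter (hφ i))
    _ = _ := by rw [ENNReal.tsum_mul_left, ← hBsum]

/-- The frequency of visits to a sequence of random small sets, each determined by the past. -/
theorem UniformlyDominatedAtRate.ae_eventually_sum_le [IsProbabilityMeasure P]
    {ν : Measure 𝒳} {ε : ℝ → ℝ} (h : UniformlyDominatedAtRate P X ν ε)
    (hX : ∀ n, Measurable (X n)) {δ : ℝ} (hδ : 0 < δ) {ι : ℕ → Type*} [∀ n, Countable (ι n)]
    {S : ∀ n, ι n → Set 𝒳} (hS : ∀ n i, MeasurableSet (S n i))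
    (hνS : ∀ n i, ν (S n i) < ENNReal.ofReal δ) {φ : ∀ n, Ω → ι n}
    (hφ : ∀ n i, MeasurableSet[pastSigma X n] (φ n ⁻¹' {i})) {η : ℝ} (hη : 0 < η) :
    ∀ᵐ ω ∂P, ∀ᶠ N : ℕ in atTop,
      ∑ n ∈ Finset.Icc 1 N, (S n (φ n ω)).indicator (fun _ => (1 : ℝ)) (X n ω) ≤ (ε δ + η) * N :=
  ae_eventually_sum_indicator_le (E := fun n => {ω | X n ω ∈ S n (φ n ω)}) (pastSigma_le hX)
    monotone_pastSigma (fun n _ => measurableSet_pastSigma_succ_setOf_mem (hS n) (hφ n)) (h.pos hδ)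
    (fun n hn _ hB => h.measure_inter_mem_le hX hδ (hS n) (hνS n) hn (hφ n) hB) hη

end

/-! ### Light neighborhoods of the past visits -/

section
variable {𝒳 : Type*} [MetricSpace 𝒳]

/-- The radius `ρ` for which `k` balls of radius `2 * ρ` have total mass at most `δ / 2`, when a ball
of radius `r` has mass at most `c * r ^ d`. The factor `2` leaves room for moving the centers of
balls of radius `ρ` by less than `ρ`. For `k = 0` and `d > 0` the value is `0`. -/
noncomputable def smallRadius (c d δ : ℝ) (k : ℕ) : ℝ := (δ / (2 * c * k)) ^ (1 / d) / 2

theorem smallRadius_pos {c d δ : ℝ} (hc : 0 < c) (hδ : 0 < δ) {k : ℕ} (hk : 0 < k) :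
    0 < smallRadius c d δ k := by
  have : (0 : ℝ) < k := by exact_mod_cast hk
  unfold smallRadius
  positivity

theorem smallRadius_anti {c d δ : ℝ} (hc : 0 < c) (hd : 0 < d) (hδ : 0 < δ) {k l : ℕ} (hk : 0 < k)
    (hkl : k ≤ l) : smallRadius c d δ l ≤ smallRadius c d δ k := by
  have h1 : (0 : ℝ) < k := by exact_mod_cast hk
  have h2 : (k : ℝ) ≤ l := by exact_mod_cast hkl
  unfold smallRadius
  gcongr

theorem two_mul_smallRadius_rpow {c d δ : ℝ} (hc : 0 < c) (hd : 0 < d) (hδ : 0 < δ) (k : ℕ) :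
    (2 * smallRadius c d δ k) ^ d = δ / (2 * c * k) := by
  unfold smallRadius
  rw [mul_div_cancel₀ _ (by norm_num : (2 : ℝ) ≠ 0), ← Real.rpow_mul (by positivity),
    one_div_mul_cancel hd.ne', Real.rpow_one]

theorem measure_biUnion_ball_smallRadius_lt [MeasurableSpace 𝒳] {ν : Measure 𝒳} {c d δ : ℝ}
    (hc : 0 < c) (hd : 0 < d) (hδ : 0 < δ)
    (hν : ∀ (x : 𝒳) (r : ℝ), 0 < r → ν (Metric.ball x r) ≤ ENNReal.ofReal (c * r ^ d))
    {ι : Type*} (s : Finset ι) (y : ι → 𝒳) {k : ℕ} (hs : s.card ≤ k) :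
    ν (⋃ i ∈ s, Metric.ball (y i) (2 * smallRadius c d δ k)) < ENNReal.ofReal δ := by
  rcases Nat.eq_zero_or_pos k with rfl | hk
  · have : s = ∅ := Finset.card_eq_zero.1 (by omega)
    simpa [this] using hδ
  have hk' : (0 : ℝ) < k := by exact_mod_cast hk
  have hr := smallRadius_pos (d := d) hc hδ hk
  calc _ ≤ ∑ i ∈ s, ν (Metric.ball (y i) (2 * smallRadius c d δ k)) := measure_biUnion_finset_le _ _
    _ ≤ ∑ _i ∈ s, ENNReal.ofReal (c * (δ / (2 * c * k))) := by
        refine Finset.sum_le_sum fun i _ => ?_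
        rw [← two_mul_smallRadius_rpow hc hd hδ]
        exact hν _ _ (by positivity)
    _ = s.card * ENNReal.ofReal (c * (δ / (2 * c * k))) := by simp
    _ ≤ k * ENNReal.ofReal (c * (δ / (2 * c * k))) := by gcongr
    _ = ENNReal.ofReal (δ / 2) := by
        rw [← ENNReal.ofReal_natCast, ← ENNReal.ofReal_mul (by positivity)]
        congr 1
        field_simp
    _ < ENNReal.ofReal δ := (ENNReal.ofReal_lt_ofReal_iff hδ).2 (by linarith)

/-- A measurable rounding of the points of a separable space to a dense sequence. -/
theorem exists_measurable_dist_denseSeq_lt [TopologicalSpace.SeparableSpace 𝒳] [Nonempty 𝒳]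
    [MeasurableSpace 𝒳] [BorelSpace 𝒳] (r : ℝ) : ∃ q : 𝒳 → ℕ, Measurable q ∧
      (0 < r → ∀ x, dist x (TopologicalSpace.denseSeq 𝒳 (q x)) < r) := by
  classical
  by_cases hr : 0 < r
  · have h : ∀ x : 𝒳, ∃ n, dist x (TopologicalSpace.denseSeq 𝒳 n) < r := by
      intro x
      obtain ⟨_, ⟨n, rfl⟩, hn⟩ :=
        Metric.mem_closure_iff.1 (TopologicalSpace.denseRange_denseSeq 𝒳 x) r hr
      exact ⟨n, hn⟩
    refine ⟨fun x => Nat.find (h x), measurable_find h fun n => ?_, fun _ x => Nat.find_spec (h x)⟩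
    exact (Metric.isOpen_ball (x := TopologicalSpace.denseSeq 𝒳 n) (ε := r)).measurableSet
  · exact ⟨fun _ => 0, measurable_const, fun h => absurd h hr⟩

theorem measurableSet_visits_eq {Ω 𝒴 : Type*} [MeasurableSpace 𝒴] {X : ℕ → Ω → 𝒴} {A : Set 𝒴}
    (hA : MeasurableSet A) (n : ℕ) (T : Finset ℕ) :
    MeasurableSet[pastSigma X n] {ω | visits (fun m => X m ω) A n = T} := by
  have heq : {ω | visits (fun m => X m ω) A n = T} =
      ⋂ m : ℕ, {ω | (m < n ∧ X m ω ∈ A) ↔ m ∈ T} := by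
    ext ω
    simp [visits, Finset.ext_iff]
  rw [heq]
  refine MeasurableSet.iInter fun m => ?_
  by_cases hm : m < n
  · have hXA : MeasurableSet[pastSigma X n] {ω | X m ω ∈ A} := measurable_pastSigma hm hA
    by_cases hT : m ∈ T
    · simpa [hm, hT] using hXA
    · have heq' : {ω | (m < n ∧ X m ω ∈ A) ↔ m ∈ T} = {ω | X m ω ∈ A}ᶜ := by
        ext ω
        simp [hm, hT]
      rw [heq']
      exact hXA.compl
  · simp [hm]

end

/-- Almost surely, for large `N`, the fraction of the times `n ≤ N` at which `X n` is close to a past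
visit of `X` to `A` is at most about `ε δ`, where *close* is measured by the radius that keeps the
neighborhood of those visits lighter than `δ`. -/
theorem UniformlyDominatedAtRate.ae_eventually_sum_near_le {Ω 𝒳 : Type*} [MeasurableSpace Ω]
    {P : Measure Ω} [IsProbabilityMeasure P] [MetricSpace 𝒳] [TopologicalSpace.SeparableSpace 𝒳]
    [MeasurableSpace 𝒳] [BorelSpace 𝒳] {X : ℕ → Ω → 𝒳} {ν : Measure 𝒳} {ε : ℝ → ℝ}
    (h : UniformlyDominatedAtRate P X ν ε) (hX : ∀ n, Measurable (X n)) {c d δ : ℝ}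
    (hc : 0 < c) (hd : 0 < d) (hδ : 0 < δ)
    (hν : ∀ (x : 𝒳) (r : ℝ), 0 < r → ν (Metric.ball x r) ≤ ENNReal.ofReal (c * r ^ d))
    {A : Set 𝒳} (hA : MeasurableSet A) {η : ℝ} (hη : 0 < η) :
    ∀ᵐ ω ∂P, ∀ᶠ N : ℕ in atTop,
      ∑ n ∈ Finset.Icc 1 N, {n | ∃ m < n, X m ω ∈ A ∧ dist (X n ω) (X m ω) <
        smallRadius c d δ (visits (fun m => X m ω) A n).card}.indicator (fun _ => (1 : ℝ)) n ≤
      (ε δ + η) * N := by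
  classical
  obtain ⟨ω₀⟩ : Nonempty Ω := nonempty_of_isProbabilityMeasure P
  have : Nonempty 𝒳 := ⟨X 0 ω₀⟩
  choose q hqm hq using fun k : ℕ =>
    exists_measurable_dist_denseSeq_lt (𝒳 := 𝒳) (smallRadius c d δ k)
  -- The random set is recorded by the set of visits and by the rounded positions.
  set φ : ∀ n, Ω → Finset ℕ × (Fin n → ℕ) := fun n ω =>
    (visits (fun m => X m ω) A n,
      fun m => q (visits (fun m => X m ω) A n).card (X m ω)) with hφdef
  set S : ∀ n, Finset ℕ × (Fin n → ℕ) → Set 𝒳 := fun n i =>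
    ⋃ m ∈ Finset.univ.filter (fun m : Fin n => (m : ℕ) ∈ i.1),
      Metric.ball (TopologicalSpace.denseSeq 𝒳 (i.2 m)) (2 * smallRadius c d δ i.1.card) with hSdef
  have hφ : ∀ n i, MeasurableSet[pastSigma X n] (φ n ⁻¹' {i}) := by
    rintro n ⟨T, g⟩
    have heq : φ n ⁻¹' {(T, g)} = {ω | visits (fun m => X m ω) A n = T} ∩
        ⋂ m : Fin n, X m ⁻¹' (q T.card ⁻¹' {g m}) := by
      ext ω
      simp only [hφdef, Set.mem_preimage, Set.mem_singleton_iff, Prod.mk.injEq, Set.mem_inter_iff,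
        Set.mem_ofPred_eq, Set.mem_iInter, funext_iff]
      refine and_congr_right fun hT => ?_
      rw [hT]
    rw [heq]
    refine (measurableSet_visits_eq hA n T).inter (MeasurableSet.iInter fun m => ?_)
    exact measurable_pastSigma m.2 (hqm _ (measurableSet_singleton _))
  have hS : ∀ n i, MeasurableSet (S n i) := fun n i =>
    Finset.measurableSet_biUnion _ fun _ _ => Metric.isOpen_ball.measurableSet
  have hνS : ∀ n i, ν (S n i) < ENNReal.ofReal δ := fun n i =>
    measure_biUnion_ball_smallRadius_lt hc hd hδ hν _ _
      (Finset.card_le_card_of_injOn (fun m : Fin n => (m : ℕ)) (by intro m hm; simpa using hm)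
        Fin.val_injective.injOn)
  filter_upwards [h.ae_eventually_sum_le hX hδ hS hνS hφ hη] with ω hω
  filter_upwards [hω] with N hN
  refine le_trans (Finset.sum_le_sum fun n _ => ?_) hN
  by_cases hn : n ∈ {n | ∃ m < n, X m ω ∈ A ∧ dist (X n ω) (X m ω) <
        smallRadius c d δ (visits (fun m => X m ω) A n).card}
  · rw [Set.indicator_of_mem hn]
    obtain ⟨m, hmn, hmA, hdist⟩ := hn
    have hmT : m ∈ visits (fun m => X m ω) A n := by simp [visits, hmn, hmA]
    have hr := smallRadius_pos (d := d) hc hδ (Finset.card_pos.2 ⟨m, hmT⟩)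
    rw [Set.indicator_of_mem]
    simp only [hSdef, hφdef, Set.mem_iUnion]
    refine ⟨⟨m, hmn⟩, by simpa using hmT, ?_⟩
    rw [Metric.mem_ball]
    have h1 := hq _ hr (X m ω)
    have h2 := dist_triangle (X n ω) (X m ω) (TopologicalSpace.denseSeq 𝒳
      (q (visits (fun m => X m ω) A n).card (X m ω)))
    simp only
    linarith
  · rw [Set.indicator_of_notMem hn]
    exact Set.indicator_nonneg (fun _ _ => zero_le_one) _

/-! ### The asymptotic rate of the nearest neighbor process -/

theorem visits_card_le {𝒳 : Type*} (x : ℕ → 𝒳) (A : Set 𝒳) (N : ℕ) :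
    ((visits x A N).card : ℝ) ≤
      1 + ∑ n ∈ Finset.Icc 1 N, A.indicator (fun _ => (1 : ℝ)) (x n) := by
  classical
  have hsub : visits x A N ⊆ insert 0 ((Finset.Icc 1 N).filter fun n => x n ∈ A) := by
    intro m hm
    simp only [visits, Finset.mem_filter, Finset.mem_range] at hm
    simp only [Finset.mem_insert, Finset.mem_filter, Finset.mem_Icc]
    rcases Nat.eq_zero_or_pos m with h | h
    · exact Or.inl h
    · exact Or.inr ⟨⟨h, hm.1.le⟩, hm.2⟩
  have h := (Finset.card_le_card hsub).trans (Finset.card_insert_le _ _)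
  have hsum : ∑ n ∈ Finset.Icc 1 N, A.indicator (fun _ => (1 : ℝ)) (x n) =
      ((Finset.Icc 1 N).filter fun n => x n ∈ A).card := by
    simp only [Set.indicator_apply, Finset.sum_boole]
  rw [hsum]
  have h' : ((visits x A N).card : ℝ) ≤
      ((((Finset.Icc 1 N).filter fun n => x n ∈ A).card + 1 : ℕ) : ℝ) := by exact_mod_cast h
  push_cast at h'
  linarith

/-- The pathwise comparison: a visit of the nearest neighbor to `A` is either close to a past visit
to `A`, or it is one of the few far ones. -/
theorem sum_indicator_nearest_le {𝒳 : Type*} [MetricSpace 𝒳] {K : ℕ}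
    (hK : HasHalvingCovers 𝒳 K)
    {x x' : ℕ → 𝒳} {A : Set 𝒳} {D c d δ : ℝ}
    (hNN : IsNearestNeighborSeq x x')
    (hD : 0 < D) (hdist : ∀ y z : 𝒳, dist y z ≤ D) (hd : 1 ≤ d) (hKd : (K : ℝ) ≤ 2 ^ d)
    (hc : 0 < c) (hδ : 0 < δ) (N : ℕ) :
    ∑ n ∈ Finset.Icc 1 N, A.indicator (fun _ => (1 : ℝ)) (x' n) ≤
      ∑ n ∈ Finset.Icc 1 N, {n | ∃ m < n, x m ∈ A ∧ dist (x n) (x m) <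
        smallRadius c d δ (visits x A n).card}.indicator (fun _ => (1 : ℝ)) n +
      ((2 : ℝ) ^ d) ^ 4 * (3 + Real.posLog ((2 * D) ^ d * (2 * c) / δ) / Real.log 2) *
        (visits x A N).card := by
  classical
  have hd0 : 0 < d := by linarith
  set M := (visits x A N).card with hM
  have hvis : ∀ {m n : ℕ}, m < n → n ≤ N → x m ∈ A →
      m ∈ visits x A n ∧ visits x A n ⊆ visits x A N := by
    intro m n hmn hnN hm
    refine ⟨by simp [visits, hmn, hm], fun k hk => ?_⟩
    simp only [visits, Finset.mem_filter, Finset.mem_range] at hk ⊢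
    exact ⟨by omega, hk.2⟩
  have hfar : (((Finset.Icc 1 N).filter fun n => x' n ∈ A ∧
      smallRadius c d δ M ≤ dist (x n) (x' n)).card : ℝ) ≤
      ((2 : ℝ) ^ d) ^ 4 * (3 + Real.posLog ((2 * D) ^ d * (2 * c) / δ) / Real.log 2) * M := by
    rcases Nat.eq_zero_or_pos M with h0 | hpos
    · rw [h0, Finset.filter_false_of_mem]
      · simp
      · intro n hn hcon
        obtain ⟨hn1, hn2⟩ := Finset.mem_Icc.1 hn
        obtain ⟨m, hm, hxm⟩ := (hNN n hn1).1
        have := hvis hm hn2 (hxm ▸ hcon.1)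
        have := Finset.card_pos.2 ⟨m, this.2 this.1⟩
        omega
    · have hr := smallRadius_pos (d := d) hc hδ hpos
      have hM0 : (0 : ℝ) < M := by exact_mod_cast hpos
      refine card_far_nearest_le hK hNN hD hdist hd hKd hr (by positivity) N hpos (le_of_eq ?_)
      have e1 : D / smallRadius c d δ M = (2 * D) / (2 * smallRadius c d δ M) := by
        rw [mul_div_mul_left _ _ (by norm_num)]
      rw [e1, Real.div_rpow (by positivity) (by positivity), two_mul_smallRadius_rpow hc hd0 hδ,
        ← hM]
      field_simp
  have hcard : (((Finset.Icc 1 N).filter fun n => x' n ∈ A ∧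
      smallRadius c d δ M ≤ dist (x n) (x' n)).card : ℝ) = ∑ n ∈ Finset.Icc 1 N,
        if x' n ∈ A ∧ smallRadius c d δ M ≤ dist (x n) (x' n) then (1 : ℝ) else 0 := by
    simp only [Finset.sum_boole]
  refine le_trans ?_ (add_le_add_right hfar _)
  rw [hcard, ← Finset.sum_add_distrib]
  refine Finset.sum_le_sum fun n hn => ?_
  obtain ⟨hn1, hn2⟩ := Finset.mem_Icc.1 hn
  by_cases hxA : x' n ∈ A
  · rw [Set.indicator_of_mem hxA]
    by_cases hfar' : smallRadius c d δ M ≤ dist (x n) (x' n)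
    · rw [if_pos ⟨hxA, hfar'⟩]
      have : 0 ≤ {n | ∃ m < n, x m ∈ A ∧ dist (x n) (x m) <
        smallRadius c d δ (visits x A n).card}.indicator (fun _ => (1 : ℝ)) n :=
          Set.indicator_nonneg (fun _ _ => zero_le_one) _
      linarith
    · obtain ⟨m, hm, hxm⟩ := (hNN n hn1).1
      have hv := hvis hm hn2 (hxm ▸ hxA)
      have hanti := smallRadius_anti hc hd0 hδ (Finset.card_pos.2 ⟨m, hv.1⟩)
        (Finset.card_le_card hv.2)
      rw [Set.indicator_of_mem (s := {n | ∃ m < n, x m ∈ A ∧ dist (x n) (x m) <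
        smallRadius c d δ (visits x A n).card}) ⟨m, hm, hxm ▸ hxA, ?_⟩]
      · split_ifs <;> norm_num
      · rw [← hxm]
        exact (not_le.1 hfar').trans_le hanti
  · rw [Set.indicator_of_notMem hxA]
    refine add_nonneg (Set.indicator_nonneg (fun _ _ => zero_le_one) _) ?_
    split_ifs <;> norm_num

/-- The averages are nonnegative, so the real `limsup` is a genuine one and eventual bounds pass to
it. -/
theorem asymptoticRate_le {Ω 𝒳 : Type*} {Z : ℕ → Ω → 𝒳} {A : Set 𝒳} {ω : Ω} {b : ℝ}
    (h : ∀ᶠ N : ℕ in atTop,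
      ∑ n ∈ Finset.Icc 1 N, A.indicator (fun _ => (1 : ℝ)) (Z n ω) ≤ b * N) :
    asymptoticRate Z A ω ≤ b := by
  have hnonneg : ∀ N : ℕ, 0 ≤ (1 / (N : ℝ)) *
      ∑ n ∈ Finset.Icc 1 N, A.indicator (fun _ => (1 : ℝ)) (Z n ω) := fun N =>
    mul_nonneg (by positivity)
      (Finset.sum_nonneg fun n _ => Set.indicator_nonneg (fun _ _ => zero_le_one) _)
  refine limsup_le_of_le ⟨0, fun a ha => ?_⟩ ?_
  · obtain ⟨N, hN⟩ := (eventually_map.1 ha).exists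
    exact (hnonneg N).trans hN
  · filter_upwards [h, eventually_gt_atTop 0] with N hN hN0
    have : (0 : ℝ) < N := by exact_mod_cast hN0
    rw [one_div, inv_mul_le_iff₀ this, mul_comm]
    exact hN

theorem UniformlyDominatedAtRate.ae_eventually_sum_visits_le {Ω 𝒳 : Type*} [MeasurableSpace Ω]
    {P : Measure Ω} [IsProbabilityMeasure P] [MeasurableSpace 𝒳] {X : ℕ → Ω → 𝒳} {ν : Measure 𝒳}
    {ε : ℝ → ℝ} (h : UniformlyDominatedAtRate P X ν ε) (hX : ∀ n, Measurable (X n)) {δ : ℝ}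
    (hδ : 0 < δ) {A : Set 𝒳} (hA : MeasurableSet A) (hνA : ν A < ENNReal.ofReal δ) {η : ℝ}
    (hη : 0 < η) :
    ∀ᵐ ω ∂P, ∀ᶠ N : ℕ in atTop,
      ∑ n ∈ Finset.Icc 1 N, A.indicator (fun _ => (1 : ℝ)) (X n ω) ≤ (ε δ + η) * N :=
  h.ae_eventually_sum_le hX hδ (ι := fun _ => Unit) (S := fun _ _ => A) (fun _ _ => hA)
    (fun _ _ => hνA) (φ := fun _ _ => ()) (fun _ _ => by simp) hη

/-- The bound in an upper doubling space with at least two points, for a single `δ`. -/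
theorem UniformlyDominatedAtRate.ae_asymptoticRate_nearest_lt {Ω 𝒳 : Type*} [MeasurableSpace Ω]
    {P : Measure Ω} [IsProbabilityMeasure P] [MetricSpace 𝒳] [TopologicalSpace.SeparableSpace 𝒳]
    [MeasurableSpace 𝒳] [BorelSpace 𝒳] {X X' : ℕ → Ω → 𝒳} {ν : Measure 𝒳} {ε : ℝ → ℝ}
    (h : UniformlyDominatedAtRate P X ν ε) (hX : ∀ n, Measurable (X n))
    (hNN : IsNearestNeighborProcess P X X') {K : ℕ} {D c d δ δ₀ : ℝ}
    (hK : HasHalvingCovers 𝒳 K)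
    (hD : 0 < D) (hdist : ∀ y z : 𝒳, dist y z ≤ D) (hd : 1 ≤ d) (hKd : (K : ℝ) ≤ 2 ^ d)
    (hc : 0 < c) (hν : ∀ (x : 𝒳) (r : ℝ), 0 < r → ν (Metric.ball x r) ≤ ENNReal.ofReal (c * r ^ d))
    (hδ : 0 < δ) (hδ₀ : 0 < δ₀) {A : Set 𝒳} (hA : MeasurableSet A)
    (hνA : ν A < ENNReal.ofReal δ₀) {b : ℝ}
    (hb : ((2 : ℝ) ^ d) ^ 4 * (3 + Real.posLog ((2 * D) ^ d * (2 * c) / δ) / Real.log 2) * ε δ₀ +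
      ε δ < b) :
    ∀ᵐ ω ∂P, asymptoticRate X' A ω < b := by
  set C := ((2 : ℝ) ^ d) ^ 4 * (3 + Real.posLog ((2 * D) ^ d * (2 * c) / δ) / Real.log 2) with hC
  have hC0 : 0 ≤ C := by
    have : 0 ≤ Real.posLog ((2 * D) ^ d * (2 * c) / δ) / Real.log 2 :=
      div_nonneg Real.posLog_nonneg (Real.log_nonneg (by norm_num))
    positivity
  obtain ⟨η, hη, hηb⟩ : ∃ η : ℝ, 0 < η ∧ C * (ε δ₀ + η) + (ε δ + η) + η < b := by
    refine ⟨(b - (C * ε δ₀ + ε δ)) / (2 * (C + 2)), div_pos (by linarith) (by positivity), ?_⟩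
    have : (b - (C * ε δ₀ + ε δ)) / (2 * (C + 2)) * (C + 2) = (b - (C * ε δ₀ + ε δ)) / 2 := by
      field_simp
    linarith
  filter_upwards [hNN, h.ae_eventually_sum_visits_le hX hδ₀ hA hνA hη,
    h.ae_eventually_sum_near_le hX hc (by linarith : 0 < d) hδ hν hA hη] with ω h1 h2 h3
  refine lt_of_le_of_lt (asymptoticRate_le ?_) hηb
  have h4 : ∀ᶠ N : ℕ in atTop, C ≤ η * N :=
    (tendsto_natCast_atTop_atTop.const_mul_atTop hη).eventually_ge_atTop C
  filter_upwards [h2, h3, h4] with N hN2 hN3 hN4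
  have hp := sum_indicator_nearest_le (A := A) hK (x := fun n => X n ω) (x' := fun n => X' n ω) h1
    hD hdist hd hKd hc hδ N
  have hv := mul_le_mul_of_nonneg_left
    ((visits_card_le (fun n => X n ω) A N).trans (add_le_add_right hN2 1)) hC0
  refine (hp.trans (add_le_add hN3 hv)).trans ?_
  linarith

theorem mul_posLog_div_le {a : ℝ} (ha : 0 < a) (L δ : ℝ) :
    a * (3 + Real.posLog (L / δ) / Real.log 2) ≤
      a * (3 + Real.posLog L / Real.log 2) + a / Real.log 2 * Real.posLog (1 / δ) := by
  have hlog2 : 0 < Real.log 2 := Real.log_pos (by norm_num)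
  have h : Real.posLog (L / δ) ≤ Real.posLog L + Real.posLog (1 / δ) := by
    rw [div_eq_mul_one_div]
    exact Real.posLog_mul
  have := mul_le_mul_of_nonneg_left h (by positivity : 0 ≤ a / Real.log 2)
  calc _ = a * 3 + a / Real.log 2 * Real.posLog (L / δ) := by ring
    _ ≤ a * 3 + a / Real.log 2 * (Real.posLog L + Real.posLog (1 / δ)) := by linarith
    _ = _ := by ring

/-- The rate tends to zero along with `δ₀`, since `δ` can be chosen before `δ₀`. -/
theorem ergodicallyDominated_of_lt_iInf {Ω 𝒳 : Type*} [MeasurableSpace Ω] {P : Measure Ω}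
    [MeasurableSpace 𝒳] {Z : ℕ → Ω → 𝒳} {ν : Measure 𝒳} {ε : ℝ → ℝ} {c₁ c₂ : ℝ} (hc₁ : 0 < c₁)
    (hc₂ : 0 < c₂) (hε : Tendsto ε (𝓝[>] 0) (𝓝 0)) (hpos : ∀ δ, 0 < δ → 0 < ε δ)
    (h : ∀ δ₀ : ℝ, 0 < δ₀ → ∀ A : Set 𝒳, MeasurableSet A → ν A < ENNReal.ofReal δ₀ →
      ∀ᵐ ω ∂P, asymptoticRate Z A ω < ⨅ δ : Set.Ioi (0 : ℝ),
        ((c₁ + c₂ * Real.posLog (1 / (δ : ℝ))) * ε δ₀ + ε δ)) :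
    ErgodicallyDominated P Z ν := by
  intro e he
  have hsmall : ∀ t : ℝ, 0 < t → ∃ δ, 0 < δ ∧ ε δ < t := by
    intro t ht
    obtain ⟨δ, h1, h2⟩ := ((hε.eventually_lt_const ht).and self_mem_nhdsWithin).exists
    exact ⟨δ, h2, h1⟩
  obtain ⟨δ, hδ, hεδ⟩ := hsmall (e / 2) (by positivity)
  have hC : 0 < c₁ + c₂ * Real.posLog (1 / δ) := by
    have : 0 ≤ Real.posLog (1 / δ) := Real.posLog_nonneg
    positivity
  obtain ⟨δ₀, hδ₀, hεδ₀⟩ := hsmall (e / 2 / (c₁ + c₂ * Real.posLog (1 / δ))) (by positivity)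
  refine ⟨δ₀, hδ₀, fun A hA hνA => ?_⟩
  filter_upwards [h δ₀ hδ₀ A hA hνA] with ω hω
  have hbdd : BddBelow (Set.range fun δ : Set.Ioi (0 : ℝ) =>
      (c₁ + c₂ * Real.posLog (1 / (δ : ℝ))) * ε δ₀ + ε δ) := by
    refine ⟨0, Set.forall_mem_range.2 fun δ' => ?_⟩
    have h1 : 0 ≤ Real.posLog (1 / (δ' : ℝ)) := Real.posLog_nonneg
    have h2 := hpos δ₀ hδ₀
    have h3 := hpos δ' δ'.2
    positivity
  refine (hω.trans_le (ciInf_le hbdd ⟨δ, hδ⟩)).trans ?_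
  rw [lt_div_iff₀ hC] at hεδ₀
  simp only
  linarith

theorem mainTheorem2 {𝒳 : Type*} [MetricSpace 𝒳] [TopologicalSpace.SeparableSpace 𝒳]
    [MeasurableSpace 𝒳] [BorelSpace 𝒳] (ν : Measure 𝒳) [IsFiniteMeasure ν]
    (hbdd : Bornology.IsBounded (Set.univ : Set 𝒳)) (hν : IsUpperDoubling ν) :
    ∃ c₁ c₂ : ℝ, 0 < c₁ ∧ 0 < c₂ ∧
      ∀ (Ω : Type*) [MeasurableSpace Ω] (P : Measure Ω) [IsProbabilityMeasure P]
        (X X' : ℕ → Ω → 𝒳) (ε : ℝ → ℝ),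
        (∀ n, Measurable (X n)) →
        UniformlyDominatedAtRate P X ν ε →
        IsNearestNeighborProcess P X X' →
        (∀ δ₀ : ℝ, 0 < δ₀ → ∀ A : Set 𝒳, MeasurableSet A → ν A < ENNReal.ofReal δ₀ →
          ∀ᵐ ω ∂P, asymptoticRate X' A ω <
            ⨅ δ : Set.Ioi (0 : ℝ),
              ((c₁ + c₂ * Real.posLog (1 / (δ : ℝ))) * ε δ₀ + ε δ)) ∧
        ErgodicallyDominated P X' ν := by
  obtain ⟨d, hd0, hdoub, c, hc, hmass⟩ := hν
  obtain ⟨D₀, hD₀⟩ := Metric.isBounded_iff.1 hbdd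
  set D := max D₀ 1 with hDdef
  have hD : 0 < D := lt_max_of_lt_right one_pos
  have hdist : ∀ y z : 𝒳, dist y z ≤ D := fun y z =>
    (hD₀ (Set.mem_univ y) (Set.mem_univ z)).trans (le_max_left _ _)
  set K := ⌊(2 : ℝ) ^ d⌋₊ with hKdef
  have hK : HasHalvingCovers 𝒳 K := by
    intro x r hr
    obtain ⟨t, ht, hcov⟩ := hdoub x r hr
    exact ⟨t, Nat.le_floor ht, hcov⟩
  have hKd : (K : ℝ) ≤ 2 ^ d := Nat.floor_le (by positivity)
  have hlog2 : 0 < Real.log 2 := Real.log_pos (by norm_num)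
  set a := ((2 : ℝ) ^ d) ^ 4 with hadef
  have ha : 0 < a := by positivity
  set L := (2 * D) ^ d * (2 * c) with hLdef
  set c₀ := a * (3 + Real.posLog L / Real.log 2) with hc₀
  have hc₀pos : 0 ≤ c₀ := by
    have : 0 ≤ Real.posLog L / Real.log 2 := div_nonneg Real.posLog_nonneg hlog2.le
    positivity
  refine ⟨c₀ + 2, a / Real.log 2, by positivity, by positivity, ?_⟩
  intro Ω _ P _ X X' ε hX hdom hNN
  have hpos : ∀ δ, 0 < δ → 0 < ε δ := fun δ hδ => hdom.pos hδ
  suffices hmain : ∀ δ₀ : ℝ, 0 < δ₀ → ∀ A : Set 𝒳, MeasurableSet A → ν A < ENNReal.ofReal δ₀ →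
      ∀ᵐ ω ∂P, asymptoticRate X' A ω < ⨅ δ : Set.Ioi (0 : ℝ),
        ((c₀ + 2 + a / Real.log 2 * Real.posLog (1 / (δ : ℝ))) * ε δ₀ + ε δ) from
    ⟨hmain, ergodicallyDominated_of_lt_iInf (by positivity) (by positivity) hdom.1 hpos hmain⟩
  intro δ₀ hδ₀ A hA hνA
  have hε₀ := hpos δ₀ hδ₀
  -- A nearly optimal `δ`; the slack is paid for by the summand `2` in the first constant.
  have : Nonempty (Set.Ioi (0 : ℝ)) := ⟨⟨1, Set.mem_Ioi.2 one_pos⟩⟩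
  obtain ⟨⟨δ, hδ⟩, hlt⟩ := exists_lt_of_ciInf_lt (lt_add_of_pos_right
    (⨅ δ : Set.Ioi (0 : ℝ), ((c₀ + 2 + a / Real.log 2 * Real.posLog (1 / (δ : ℝ))) * ε δ₀ + ε δ))
    hε₀)
  have hδpos : 0 < δ := hδ
  have hεδ := hpos δ hδpos
  simp only at hlt
  have hlogδ : 0 ≤ a / Real.log 2 * Real.posLog (1 / δ) :=
    mul_nonneg (by positivity) Real.posLog_nonneg
  by_cases hd : 1 ≤ d
  · refine hdom.ae_asymptoticRate_nearest_lt hX hNN hK hD hdist hd hKd hc hmass hδpos hδ₀ hA hνA ?_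
    have h1 := mul_le_mul_of_nonneg_right
      (mul_posLog_div_le ha L δ) hε₀.le
    linarith
  · -- For `d < 1` there is only one point, and `X'` visits `A` whenever `X` does.
    have hK1 : K ≤ 1 := by
      have h2 : (2 : ℝ) ^ d < 2 := by
        simpa using Real.rpow_lt_rpow_of_exponent_lt (by norm_num : (1 : ℝ) < 2) (not_le.1 hd)
      have : K < 2 := (Nat.floor_lt (by positivity)).2 (by exact_mod_cast h2)
      omega
    have hsub : Subsingleton 𝒳 := subsingleton_of_halving_by_one fun x r hr => by
      obtain ⟨t, ht, hcov⟩ := hK x r hr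
      exact ⟨t, ht.trans hK1, hcov⟩
    obtain ⟨η, hη, hηb⟩ := exists_between hεδ
    filter_upwards [hdom.ae_eventually_sum_visits_le hX hδ₀ hA hνA hη] with ω hω
    refine lt_of_le_of_lt (asymptoticRate_le (b := ε δ₀ + η) ?_) ?_
    · have heq : ∀ n, X' n ω = X n ω := fun n => Subsingleton.elim _ _
      simpa only [heq] using hω
    · have h1 := mul_nonneg hlogδ hε₀.le
      have h2 := mul_nonneg hc₀pos hε₀.le
      linarith
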